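/- Graphs are finite and simple. Let $G$ be a connected graph. A vertex $w$ \emph{strongly resolves} two vertices $u,v$ of $G$ if some shortest $u$-$w$ path contains $v$ or some shortest $v$-$w$ path contains $u$. A set $W$ of vertices is a \emph{strong resolving set} if every pair of distinct vertices is strongly resolved by some $w\in W$. The \emph{strong dimension} $\beta_s(G)$ is the smallest cardinality of a strong resolving set of $G$, and the \emph{threshold strong dimension} $\tau_s(G)$ is the smallest value of $\beta_s(H)$ over all graphs $H$ that contain $G$ as a spanning subgraph. Let $P_n$ be the path with vertices $0,1,\dots,n-1$ in order, and let $P_n^{\boxtimes,k}$ be the strong product of $k$ copies of $P_n$: distinct $k$-tuples are adjacent if and only if in every coordinate they are equal or adjacent. For $W=\{w_1,\dots,w_k\}\subseteq V(G)$ (with $w_1,\dots,w_k$ distinct), a \emph{$W$-resolved embedding} of $G$ in $P_n^{\boxtimes,k}$ is an injective, edge-preserving map $\varphi:V(G)\to V(P_n^{\boxtimes,k})$ such that, for all $x\in V(G)$ and all $i$, the $i$-th coordinate of $\varphi(x)$ is the distance between $\varphi(x)$ and $\varphi(w_i)$ in $\varphi(G)$, the subgraph of $P_n^{\boxtimes,k}$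 induced by the range of $\varphi$. It is \emph{isometric} if distances in $\varphi(G)$ agree with distances in $P_n^{\boxtimes,k}$. For integers $k_1,\dots,k_5\ge 1$ let $T(k_1,\dots,k_5)$ be the tree consisting of the five disjoint paths $v_1\cdots v_{k_1}$, $u_1\cdots u_{k_2}$, $x_1\cdots x_{k_3}$, $y_1\cdots y_{k_4}$, $z_1\cdots z_{k_5}$ together with the edges $v_1y_1,\ v_1z_1,\ v_{k_1}u_1,\ v_{k_1}x_1$. \textbf{Theorem.} Let $T$ be a tree. Then $\beta_s(T)=3$ if and only if $T$ has exactly four leaves (vertices of degree one). If $\beta_s(T)=3$, then $\tau_s(T)=2$. Moreover, if $\beta_s(T)=3$ and $D$ is the diameter of $T$, then $T$ is isomorphic to $T(k_1,\dots,k_5)$ for some $k_1,\dots,k_5\ge1$ with $k_2\ge k_3$ and $k_4\ge k_5$, and for every such identification of $T$ with $T(k_1,\dots,k_5)$ there is an isometric $\{y_{k_4},u_{k_2}\}$-resolved embedding of $T$ in $P_{D+1}^{\boxtimes,2}$. -/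

import Mathlib

namespace StrongDimension

/-- `w` strongly resolves `u` and `v` in `G`: some shortest `u`-`w` path contains `v`, or some
shortest `v`-`w` path contains `u`. -/
def StronglyResolves {V : Type*} (G : SimpleGraph V) (w u v : V) : Prop :=
  (∃ p : G.Walk u w, p.IsPath ∧ p.length = G.dist u w ∧ v ∈ p.support) ∨
  (∃ p : G.Walk v w, p.IsPath ∧ p.length = G.dist v w ∧ u ∈ p.support)

/-- `W` is a strong resolving set: every pair of (distinct) vertices is strongly resolved by
some vertex of `W`. -/
def IsStrongResolvingSet {V : Type*} (G : SimpleGraph V) (W : Set V) : Prop :=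
  ∀ u v : V, u ≠ v → ∃ w ∈ W, StronglyResolves G w u v

/-- The strong dimension `β_s(G)`: the smallest cardinality of a strong resolving set
(`⊤` if there is none, which happens exactly for disconnected graphs). -/
noncomputable def strongDim {V : Type*} (G : SimpleGraph V) : ℕ∞ :=
  ⨅ (W : Set V) (_ : IsStrongResolvingSet G W), W.encard

/-- The threshold strong dimension `τ_s(G)`: the smallest strong dimension among all graphs
having `G` as a spanning subgraph. -/
noncomputable def thresholdStrongDim {V : Type*} (G : SimpleGraph V) : ℕ∞ :=
  ⨅ (H : SimpleGraph V) (_ : G ≤ H), strongDim H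

/-- The set of leaves (vertices of degree one). -/
def leaves {V : Type*} (G : SimpleGraph V) : Set V :=
  {v | (G.neighborSet v).encard = 1}

/-- The strong product of `k` copies of `G`. -/
def strongPower {V : Type*} (G : SimpleGraph V) (k : ℕ) : SimpleGraph (Fin k → V) where
  Adj x y := x ≠ y ∧ ∀ i, G.Adj (x i) (y i) ∨ x i = y i
  symm := ⟨fun _ _ h => ⟨h.1.symm, fun i => (h.2 i).imp (fun a => a.symm) Eq.symm⟩⟩
  loopless := ⟨fun _ h => h.1 rfl⟩

/-- The graph `φ(G)`: the subgraph of the strong product of `k` paths `P_n`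
(with vertices `0, …, n - 1`) induced by the range of `φ`. -/
def imageGraph {V : Type*} {k n : ℕ} (φ : V → Fin k → Fin n) : SimpleGraph (Set.range φ) :=
  (strongPower (SimpleGraph.pathGraph n) k).induce (Set.range φ)

/-- `φ` is a `W`-resolved embedding of `G` in the strong product of `k` paths `P_n`, where
`W = {w 0, …, w (k - 1)}` consists of `k` distinct vertices: `φ` is injective, preserves edges, and
the `i`-th coordinate of `φ x` is the distance in `φ(G)` between `φ x` and `φ (w i)`. -/
structure IsResolvedEmbedding {V : Type*} (G : SimpleGraph V) {k n : ℕ} (w : Fin k → V)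
    (φ : V → Fin k → Fin n) : Prop where
  landmarks_injective : Function.Injective w
  injective : Function.Injective φ
  map_adj : ∀ x y, G.Adj x y → (strongPower (SimpleGraph.pathGraph n) k).Adj (φ x) (φ y)
  resolved : ∀ x i, (φ x i : ℕ) =
    (imageGraph φ).dist ⟨φ x, Set.mem_range_self x⟩ ⟨φ (w i), Set.mem_range_self (w i)⟩

/-- `φ(G)` is an isometric subgraph of the strong product of `k` paths `P_n`. -/
def HasIsometricImage {V : Type*} {k n : ℕ} (φ : V → Fin k → Fin n) : Prop :=
  ∀ a b : Set.range φ,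
    (imageGraph φ).dist a b = (strongPower (SimpleGraph.pathGraph n) k).dist a.1 b.1

/-- Vertices of the tree with four leaves, consisting of five disjoint paths
`v_1, …, v_{k₁}`, `u_1, …, u_{k₂}`, `x_1, …, x_{k₃}`, `y_1, …, y_{k₄}`, `z_1, …, z_{k₅}`.
Indices are shifted by one: `v i` stands for `v_{i+1}`, and so on. -/
inductive FourLeafVertex (k₁ k₂ k₃ k₄ k₅ : ℕ) : Type where
  | v (i : Fin k₁)
  | u (i : Fin k₂)
  | x (i : Fin k₃)
  | y (i : Fin k₄)
  | z (i : Fin k₅)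

/-- The tree obtained from the five paths by adding the edges
`v_1 y_1`, `v_1 z_1`, `v_{k₁} u_1`, `v_{k₁} x_1`. -/
def fourLeafTree (k₁ k₂ k₃ k₄ k₅ : ℕ) : SimpleGraph (FourLeafVertex k₁ k₂ k₃ k₄ k₅) :=
  SimpleGraph.fromRel fun a b =>
    match a, b with
    | .v i, .v j => (i : ℕ) + 1 = j
    | .u i, .u j => (i : ℕ) + 1 = j
    | .x i, .x j => (i : ℕ) + 1 = j
    | .y i, .y j => (i : ℕ) + 1 = j
    | .z i, .z j => (i : ℕ) + 1 = j
    | .v i, .y j => (i : ℕ) = 0 ∧ (j : ℕ) = 0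
    | .v i, .z j => (i : ℕ) = 0 ∧ (j : ℕ) = 0
    | .v i, .u j => (i : ℕ) + 1 = k₁ ∧ (j : ℕ) = 0
    | .v i, .x j => (i : ℕ) + 1 = k₁ ∧ (j : ℕ) = 0
    | _, _ => False

end StrongDimension

/-!
Leaves. A leaf is never an interior vertex of a shortest path, so two leaves are strongly resolved
only by one of themselves, and a strong resolving set misses at most one leaf. Conversely, in a tree
every shortest path from `u` to `v` can be prolonged beyond `v`, and beyond `u`, to a leaf, so all
leaves but any one suffice. Hence the strong dimension of a nontrivial tree is one less than its
number of leaves (`strongDim_eq_three_iff`).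

Classification. A tree with four leaves is rooted at one of them. It is the union of the geodesics
from the root to the other three leaves. Any two of these agree up to some branching level, and of
the three branching levels the two lowest coincide. Cutting the geodesics at the branching levels
gives a bijective homomorphism from a four-leaf tree, which is an isomorphism because the tree has
no cycles (`exists_iso_fourLeafTree`).

Embedding. Distances in a strong product of two paths are chessboard distances. The tree is placed
on a chessboard so that the landmarks sit at `(0, d)` and `(d, 0)` and the occupied points form an
isometric subgraph (`IsResolvedPlacement`); isometry reduces to the local statement that of two
occupied points one can be moved closer to the other. Laying out the path from the one landmark to
the other as a straight line would fail when `v` is long, as both side branches would have to sit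
on the same side of the line, with a gap between them. Instead the tree is folded at `v` into a
ladder (`Ladder`): `y` goes up the left rail, `v` turns at the top, `u` comes down the right rail,
`x` descends on the rungs and `z` climbs on them. When `u` is longer than `y`, the surplus of `u`
runs along the antidiagonal at the foot of the ladder. When `y` is longer, the roles are exchanged
by reversing `v`.

Threshold dimension. The occupied points with all king moves between them form a graph containing
the tree, in which the two landmarks are a strong resolving set, because the chessboard distance is
attained in one of the coordinates. A single landmark never suffices in a graph containing the tree:
`v₁` and three of its neighbours would need four different distances from the landmark, but only
three are available (`two_le_thresholdStrongDim`).
-/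

namespace StrongDimension
open SimpleGraph

/-! ### Shortest paths and strong resolution -/

section Resolution

variable {V : Type*} {G : SimpleGraph V}

theorem exists_shortest_path_mem_support_iff (hG : G.Connected) {u v w : V} :
    (∃ p : G.Walk u w, p.IsPath ∧ p.length = G.dist u w ∧ v ∈ p.support) ↔
      G.dist u w = G.dist u v + G.dist v w := by
  classical
  constructor
  · rintro ⟨p, -, hp, hv⟩
    have h1 := dist_le (p.takeUntil v hv)
    have h2 := dist_le (p.dropUntil v hv)
    have h3 := congrArg Walk.length (p.take_spec hv)
    rw [Walk.length_append] at h3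
    have h4 : G.dist u w ≤ G.dist u v + G.dist v w := hG.dist_triangle
    omega
  · intro h
    obtain ⟨p, hp⟩ := hG.exists_walk_length_eq_dist u v
    obtain ⟨q, hq⟩ := hG.exists_walk_length_eq_dist v w
    have hl : (p.append q).length = G.dist u w := by rw [Walk.length_append]; omega
    exact ⟨p.append q, Walk.isPath_of_length_eq_dist _ hl, hl, by
      rw [Walk.mem_support_append_iff]; exact Or.inl p.end_mem_support⟩

theorem stronglyResolves_iff (hG : G.Connected) {u v w : V} :
    StronglyResolves G w u v ↔
      G.dist u w = G.dist u v + G.dist v w ∨ G.dist v w = G.dist u v + G.dist u w := by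
  unfold StronglyResolves
  rw [exists_shortest_path_mem_support_iff hG, exists_shortest_path_mem_support_iff hG,
    G.dist_comm (u := v) (v := u)]

theorem eq_of_adj_of_mem_leaves {l a b : V} (hl : l ∈ leaves G) (ha : G.Adj l a)
    (hb : G.Adj l b) : a = b := by
  obtain ⟨c, hc⟩ := Set.encard_eq_one.1 (show (G.neighborSet l).encard = 1 from hl)
  have h1 : a ∈ G.neighborSet l := ha
  have h2 : b ∈ G.neighborSet l := hb
  rw [hc] at h1 h2
  exact h1.trans h2.symm

theorem exists_adj_dist_succ (hG : G.Connected) {u v : V} (h : u ≠ v) :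
    ∃ a, G.Adj v a ∧ G.dist u v = G.dist u a + 1 := by
  obtain ⟨p, hp⟩ := hG.exists_walk_length_eq_dist v u
  cases p with
  | nil => exact (h rfl).elim
  | @cons _ a _ hadj q =>
    refine ⟨a, hadj, ?_⟩
    have h1 := dist_le q
    have h2 : G.dist v u ≤ G.dist v a + G.dist a u := hG.dist_triangle
    rw [dist_eq_one_iff_adj.2 hadj] at h2
    rw [Walk.length_cons] at hp
    rw [G.dist_comm (u := u) (v := v), G.dist_comm (u := u) (v := a)]
    omega

/-- A leaf is never an interior vertex of a shortest path. -/
theorem eq_or_eq_of_mem_leaves_of_dist_eq (hG : G.Connected) {u l w : V} (hl : l ∈ leaves G)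
    (h : G.dist u w = G.dist u l + G.dist l w) : l = u ∨ l = w := by
  by_contra! hne
  obtain ⟨a, ha, hua⟩ := exists_adj_dist_succ hG hne.1.symm
  obtain ⟨b, hb, hwb⟩ := exists_adj_dist_succ hG hne.2.symm
  obtain rfl := eq_of_adj_of_mem_leaves hl ha hb
  have h2 : G.dist u w ≤ G.dist u a + G.dist a w := hG.dist_triangle
  rw [G.dist_comm (u := w) (v := a), G.dist_comm (u := w) (v := l)] at hwb
  omega

/-- Two leaves can only be strongly resolved by one of themselves. -/
theorem encard_leaves_le_of_isStrongResolvingSet (hG : G.Connected) {W : Set V}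
    (hW : IsStrongResolvingSet G W) : (leaves G).encard ≤ W.encard + 1 := by
  have hsub : (leaves G \ W).Subsingleton := by
    rintro a ⟨ha, haW⟩ b ⟨hb, hbW⟩
    by_contra hab
    obtain ⟨w, hw, hr⟩ := hW a b hab
    rcases (stronglyResolves_iff hG).1 hr with h | h
    · rcases eq_or_eq_of_mem_leaves_of_dist_eq hG hb h with h | h
      · exact hab h.symm
      · exact hbW (h ▸ hw)
    · rw [G.dist_comm (u := a) (v := b)] at h
      rcases eq_or_eq_of_mem_leaves_of_dist_eq hG ha h with h | h
      · exact hab h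
      · exact haW (h ▸ hw)
  calc (leaves G).encard ≤ (W ∪ leaves G \ W).encard :=
        Set.encard_le_encard (by rw [Set.union_sdiff_self]; exact Set.subset_union_right)
    _ ≤ W.encard + (leaves G \ W).encard := Set.encard_union_le _ _
    _ ≤ W.encard + 1 := by gcongr; exact Set.encard_le_one_iff_subsingleton.2 hsub

end Resolution

/-! ### The strong dimension of a tree -/

section Tree

variable {V : Type*} {T : SimpleGraph V}

theorem eq_of_adj_of_dist_succ (hT : T.IsTree) {u w a b : V} (ha : T.Adj a w) (hb : T.Adj b w)
    (hda : T.dist u w = T.dist u a + 1) (hdb : T.dist u w = T.dist u b + 1) : a = b := by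
  obtain ⟨p, hp⟩ := hT.1.exists_walk_length_eq_dist u a
  obtain ⟨q, hq⟩ := hT.1.exists_walk_length_eq_dist u b
  have hp' : (p.concat ha).IsPath :=
    Walk.isPath_of_length_eq_dist _ (by rw [Walk.length_concat]; omega)
  have hq' : (q.concat hb).IsPath :=
    Walk.isPath_of_length_eq_dist _ (by rw [Walk.length_concat]; omega)
  have h := congrArg Walk.penultimate ((hT.existsUnique_path u w).unique hp' hq')
  simpa using h

/-- In a finite tree a shortest path can be prolonged beyond its end until it reaches a leaf:
a farthest prolongation ends in a leaf, because any second neighbour of its end would be farther. -/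
theorem exists_leaf_dist_eq [Finite V] (hT : T.IsTree) {u v : V} (huv : u ≠ v) :
    ∃ l ∈ leaves T, T.dist u l = T.dist u v + T.dist v l := by
  obtain ⟨l, hl, hmax⟩ := Set.exists_max_image {l | T.dist u l = T.dist u v + T.dist v l}
    (fun l => T.dist u l) (Set.toFinite _) ⟨v, by simp⟩
  refine ⟨l, ?_, hl⟩
  have hl' : T.dist u l = T.dist u v + T.dist v l := hl
  have hpos := hT.1.pos_dist_of_ne huv
  have hul : u ≠ l := by rintro rfl; rw [dist_self] at hl'; omega
  obtain ⟨a, ha, hda⟩ := exists_adj_dist_succ hT.1 hul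
  refine Set.encard_eq_one.2 ⟨a, Set.eq_singleton_iff_unique_mem.2 ⟨ha, fun b hb => ?_⟩⟩
  have hlb : T.Adj l b := hb
  rcases hT.dist_eq_dist_add_one_of_adj u hlb with h | h
  · exact eq_of_adj_of_dist_succ hT hlb.symm ha.symm h hda
  · exfalso
    have h1 : T.dist u b ≤ T.dist u v + T.dist v b := hT.1.dist_triangle
    have h2 : T.dist v b ≤ T.dist v l + T.dist l b := hT.1.dist_triangle
    rw [dist_eq_one_iff_adj.2 hlb] at h2
    have h3 := hmax b (show _ = _ by omega)
    omega

theorem isStrongResolvingSet_leaves_diff_singleton [Finite V] (hT : T.IsTree) (l₀ : V) :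
    IsStrongResolvingSet T (leaves T \ {l₀}) := by
  intro u v huv
  obtain ⟨l, hl, hul⟩ := exists_leaf_dist_eq hT huv
  obtain ⟨l', hl', hul'⟩ := exists_leaf_dist_eq hT huv.symm
  by_cases h : l = l₀
  · refine ⟨l', ⟨hl', ?_⟩, (stronglyResolves_iff hT.1).2 (Or.inr ?_)⟩
    · rintro rfl
      subst h
      have := hT.1.pos_dist_of_ne huv
      have := T.dist_comm (u := u) (v := v)
      omega
    · rw [hul', T.dist_comm (u := v) (v := u)]
  · exact ⟨l, ⟨hl, h⟩, (stronglyResolves_iff hT.1).2 (Or.inl hul)⟩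

theorem encard_leaves_le_strongDim_add_one (hT : T.IsTree) :
    (leaves T).encard ≤ strongDim T + 1 := by
  unfold strongDim
  by_contra! h
  have h' : ∃ W, ∃ _ : IsStrongResolvingSet T W, W.encard + 1 < (leaves T).encard := by
    by_contra! hW
    refine absurd h (not_lt.2 ?_)
    rw [ENat.iInf_add]
    refine le_iInf fun W => ?_
    by_cases hr : IsStrongResolvingSet T W
    · simpa [hr] using hW W hr
    · simp [hr]
  obtain ⟨W, hW, hlt⟩ := h'
  exact absurd hlt (not_lt.2 (encard_leaves_le_of_isStrongResolvingSet hT.1 hW))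

theorem strongDim_add_one_le_encard_leaves [Finite V] [Nontrivial V] (hT : T.IsTree) :
    strongDim T + 1 ≤ (leaves T).encard := by
  obtain ⟨u, v, huv⟩ := exists_pair_ne V
  obtain ⟨l, hl, -⟩ := exists_leaf_dist_eq hT huv
  rw [← Set.encard_sdiff_singleton_add_one hl]
  gcongr
  exact iInf₂_le _ (isStrongResolvingSet_leaves_diff_singleton hT l)

theorem strongDim_eq_three_iff [Finite V] (hT : T.IsTree) :
    strongDim T = 3 ↔ (leaves T).encard = 4 := by
  have h1 := encard_leaves_le_strongDim_add_one hT
  rcases subsingleton_or_nontrivial V with hV | hV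
  · have h0 : strongDim T = 0 := by
      refine le_antisymm ?_ zero_le
      refine (iInf₂_le ∅ fun u v huv => (huv (Subsingleton.elim u v)).elim).trans ?_
      simp
    rw [h0] at h1 ⊢
    constructor
    · intro h; simp at h
    · intro h; rw [h] at h1; norm_num at h1
  · have h2 := le_antisymm h1 (strongDim_add_one_le_encard_leaves hT)
    rw [h2]
    constructor
    · intro h; rw [h]; norm_num
    · intro h
      have : strongDim T + 1 = 3 + 1 := by rw [h]; norm_num
      exact (ENat.add_left_injective_of_ne_top ENat.one_ne_top) this

end Tree

/-! ### Graph distances in the image of a resolved embedding -/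

section Coordinates

variable {V : Type*}

/-- The chessboard distance of the points with coordinates `(f x, g x)` and `(f y, g y)`. -/
def chebDist (f g : V → ℕ) (x y : V) : ℕ :=
  max (max (f x - f y) (f y - f x)) (max (g x - g y) (g y - g x))

theorem chebDist_self (f g : V → ℕ) (x : V) : chebDist f g x x = 0 := by
  simp [chebDist]

theorem chebDist_comm (f g : V → ℕ) (x y : V) : chebDist f g x y = chebDist f g y x := by
  unfold chebDist; omega

theorem chebDist_le_iff {f g : V → ℕ} {x y : V} {n : ℕ} : chebDist f g x y ≤ n ↔
    f x ≤ f y + n ∧ f y ≤ f x + n ∧ g x ≤ g y + n ∧ g y ≤ g x + n := by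
  unfold chebDist; omega

theorem chebDist_triangle (f g : V → ℕ) (x y z : V) :
    chebDist f g x z ≤ chebDist f g x y + chebDist f g y z := by
  have h₁ := chebDist_le_iff.1 (le_refl (chebDist f g x y))
  have h₂ := chebDist_le_iff.1 (le_refl (chebDist f g y z))
  exact chebDist_le_iff.2 (by omega)

/-- Placement of the vertices of `G` at pairwise distinct points `(f x, g x)` of the chessboard
such that edges become king moves, the coordinates are the chessboard distances from the two
landmarks `w₀` and `w₁`, and of two distinct occupied points one can be moved closer to the other by
a king move to an occupied point. The last condition says that the occupied points form an
isometric subgraph of the chessboard. -/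
structure IsResolvedPlacement (G : SimpleGraph V) (w₀ w₁ : V) (f g : V → ℕ) : Prop where
  ne : w₀ ≠ w₁
  eq_of_coords : ∀ x y, f x = f y → g x = g y → x = y
  adj_le : ∀ x y, G.Adj x y → chebDist f g x y ≤ 1
  fst_eq : ∀ x, f x = chebDist f g x w₀
  snd_eq : ∀ x, g x = chebDist f g x w₁
  descent : ∀ x y, x ≠ y →
    (∃ z, chebDist f g x z ≤ 1 ∧ chebDist f g z y < chebDist f g x y) ∨
    (∃ z, chebDist f g y z ≤ 1 ∧ chebDist f g x z < chebDist f g x y)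

/-- The graph induced by the chessboard (king's graph) on the vertices placed at `(f x, g x)`. -/
def kingGraph (f g : V → ℕ) : SimpleGraph V where
  Adj x y := x ≠ y ∧ chebDist f g x y ≤ 1
  symm := ⟨fun _ _ h => ⟨h.1.symm, by rw [chebDist_comm]; exact h.2⟩⟩
  loopless := ⟨fun _ h => h.1 rfl⟩

theorem chebDist_le_length {f g : V → ℕ} {x y : V} (p : (kingGraph f g).Walk x y) :
    chebDist f g x y ≤ p.length := by
  induction p with
  | nil => simp [chebDist_self]
  | @cons a b c h q ih =>
    have := chebDist_triangle f g a b c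
    have := h.2
    rw [Walk.length_cons]
    omega

variable {G : SimpleGraph V} {w₀ w₁ : V} {f g : V → ℕ}

theorem IsResolvedPlacement.symm (h : IsResolvedPlacement G w₀ w₁ f g) :
    IsResolvedPlacement G w₁ w₀ g f := by
  have hc : ∀ x y, chebDist g f x y = chebDist f g x y := fun x y => max_comm _ _
  exact ⟨h.ne.symm, fun x y h1 h2 => h.eq_of_coords x y h2 h1,
    by simpa only [hc] using h.adj_le, by simpa only [hc] using h.snd_eq,
    by simpa only [hc] using h.fst_eq, by simpa only [hc] using h.descent⟩

theorem IsResolvedPlacement.comp_iso {V' : Type*} {G' : SimpleGraph V'}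
    (h : IsResolvedPlacement G w₀ w₁ f g) (e : G' ≃g G) :
    IsResolvedPlacement G' (e.symm w₀) (e.symm w₁) (f ∘ e) (g ∘ e) := by
  have hc : ∀ x y, chebDist (f ∘ e) (g ∘ e) x y = chebDist f g (e x) (e y) := fun _ _ => rfl
  have hs : ∀ x, e (e.symm x) = x := e.apply_symm_apply
  refine ⟨fun h' => h.ne (e.symm.injective h'),
    fun x y h1 h2 => e.injective (h.eq_of_coords _ _ h1 h2),
    fun x y hxy => h.adj_le _ _ (e.map_adj_iff.2 hxy), fun x => ?_, fun x => ?_, fun x y hxy => ?_⟩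
  · rw [hc, hs]; exact h.fst_eq _
  · rw [hc, hs]; exact h.snd_eq _
  · simp only [hc]
    rcases h.descent (e x) (e y) (fun h' => hxy (e.injective h')) with ⟨z, hz⟩ | ⟨z, hz⟩
    · exact Or.inl ⟨e.symm z, by simpa only [hs] using hz⟩
    · exact Or.inr ⟨e.symm z, by simpa only [hs] using hz⟩

theorem IsResolvedPlacement.exists_walk (h : IsResolvedPlacement G w₀ w₁ f g) (x y : V) :
    ∃ p : (kingGraph f g).Walk x y, p.length ≤ chebDist f g x y := by
  induction hn : chebDist f g x y using Nat.strong_induction_on generalizing x y with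
  | _ n ih =>
    by_cases hxy : x = y
    · subst hxy; exact ⟨Walk.nil, by simp⟩
    rcases h.descent x y hxy with ⟨z, hz, hlt⟩ | ⟨z, hz, hlt⟩
    · obtain ⟨p, hp⟩ := ih _ (hn ▸ hlt) z y rfl
      have hxz : x ≠ z := by rintro rfl; exact lt_irrefl _ hlt
      exact ⟨Walk.cons (show (kingGraph f g).Adj x z from ⟨hxz, hz⟩) p,
        by rw [Walk.length_cons]; omega⟩
    · obtain ⟨p, hp⟩ := ih _ (hn ▸ hlt) x z rfl
      have hyz : y ≠ z := by rintro rfl; exact lt_irrefl _ hlt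
      exact ⟨p.concat (show (kingGraph f g).Adj y z from ⟨hyz, hz⟩).symm,
        by rw [Walk.length_concat]; omega⟩

theorem IsResolvedPlacement.connected (h : IsResolvedPlacement G w₀ w₁ f g) :
    (kingGraph f g).Connected :=
  have : Nonempty V := ⟨w₀⟩
  ⟨fun x y => (h.exists_walk x y).choose.reachable⟩

theorem IsResolvedPlacement.dist_eq (h : IsResolvedPlacement G w₀ w₁ f g) (x y : V) :
    (kingGraph f g).dist x y = chebDist f g x y := by
  obtain ⟨p, hp⟩ := h.exists_walk x y
  obtain ⟨q, hq⟩ := h.connected.exists_walk_length_eq_dist x y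
  exact le_antisymm ((dist_le p).trans hp) (hq ▸ chebDist_le_length q)

theorem IsResolvedPlacement.le_kingGraph (h : IsResolvedPlacement G w₀ w₁ f g) :
    G ≤ kingGraph f g :=
  fun x y hxy => ⟨hxy.ne, h.adj_le x y hxy⟩

/-- The coordinate realizing the chessboard distance of two points names the landmark that strongly
resolves them. -/
theorem IsResolvedPlacement.isStrongResolvingSet (h : IsResolvedPlacement G w₀ w₁ f g) :
    IsStrongResolvingSet (kingGraph f g) {w₀, w₁} := by
  intro u v _
  have hd : chebDist f g u v = max (max (f u - f v) (f v - f u)) (max (g u - g v) (g v - g u)) :=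
    rfl
  have key : (f u = chebDist f g u v + f v ∨ f v = chebDist f g u v + f u) ∨
      (g u = chebDist f g u v + g v ∨ g v = chebDist f g u v + g u) := by omega
  rcases key with hk | hk
  · refine ⟨w₀, by simp, (stronglyResolves_iff h.connected).2 ?_⟩
    rw [h.dist_eq, h.dist_eq, h.dist_eq, ← h.fst_eq, ← h.fst_eq]
    exact hk
  · refine ⟨w₁, by simp, (stronglyResolves_iff h.connected).2 ?_⟩
    rw [h.dist_eq, h.dist_eq, h.dist_eq, ← h.snd_eq, ← h.snd_eq]
    exact hk

theorem IsResolvedPlacement.thresholdStrongDim_le_two (h : IsResolvedPlacement G w₀ w₁ f g) :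
    thresholdStrongDim G ≤ 2 :=
  (iInf₂_le _ h.le_kingGraph).trans
    ((iInf₂_le _ h.isStrongResolvingSet).trans (Set.encard_pair h.ne).le)

theorem strongPower_pathGraph_adj_iff {n : ℕ} {a b : Fin 2 → Fin n} :
    (strongPower (pathGraph n) 2).Adj a b ↔
      a ≠ b ∧ chebDist (fun c : Fin 2 → Fin n => (c 0 : ℕ)) (fun c => (c 1 : ℕ)) a b ≤ 1 := by
  simp only [strongPower, pathGraph_adj, Fin.forall_fin_two, chebDist, Fin.ext_iff]
  refine and_congr_right fun _ => ?_
  omega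

theorem IsResolvedPlacement.exists_isResolvedEmbedding [Finite V]
    (h : IsResolvedPlacement G w₀ w₁ f g) (hG : G.Connected) :
    ∃ φ : V → Fin 2 → Fin (G.diam + 1),
      IsResolvedEmbedding G ![w₀, w₁] φ ∧ HasIsometricImage φ := by
  classical
  have hbound : ∀ x y, chebDist f g x y ≤ G.diam := fun x y => by
    have := hG.nonempty
    rw [← h.dist_eq]
    exact (hG.preconnected x y |>.dist_anti h.le_kingGraph).trans
      (dist_le_diam (connected_iff_ediam_ne_top.1 hG))
  have hf : ∀ x, f x < G.diam + 1 := fun x => by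
    have := hbound x w₀; rw [← h.fst_eq] at this; omega
  have hg : ∀ x, g x < G.diam + 1 := fun x => by
    have := hbound x w₁; rw [← h.snd_eq] at this; omega
  let φ : V → Fin 2 → Fin (G.diam + 1) := fun x => ![⟨f x, hf x⟩, ⟨g x, hg x⟩]
  have hinj : Function.Injective φ := fun x y hxy =>
    h.eq_of_coords x y (by simpa [φ] using congrFun hxy 0) (by simpa [φ] using congrFun hxy 1)
  have hadj : ∀ x y, (strongPower (pathGraph (G.diam + 1)) 2).Adj (φ x) (φ y) ↔
      (kingGraph f g).Adj x y := fun x y => by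
    rw [strongPower_pathGraph_adj_iff, hinj.ne_iff]; rfl
  let e : kingGraph f g ≃g imageGraph φ :=
    ⟨Equiv.ofInjective φ hinj, fun {x y} => hadj x y⟩
  have hdist : ∀ x y, (imageGraph φ).dist (e x) (e y) = chebDist f g x y := fun x y => by
    rw [← h.dist_eq]
    apply le_antisymm
    · obtain ⟨p, hp⟩ := h.connected.exists_walk_length_eq_dist x y
      have := dist_le (p.map e.toHom)
      rw [Walk.length_map, hp] at this
      exact this
    · obtain ⟨p, hp⟩ := (e.connected_iff.1 h.connected).exists_walk_length_eq_dist (e x) (e y)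
      have := dist_le ((p.map e.symm.toHom).copy (e.symm_apply_apply x) (e.symm_apply_apply y))
      rw [Walk.length_copy, Walk.length_map, hp] at this
      exact this
  refine ⟨φ, ⟨?_, hinj, fun x y hxy => (hadj x y).2 (h.le_kingGraph hxy), fun x i => ?_⟩, ?_⟩
  · intro i j hij
    fin_cases i <;> fin_cases j
    · rfl
    · exact (h.ne hij).elim
    · exact (h.ne hij.symm).elim
    · rfl
  · fin_cases i
    · exact (h.fst_eq x).trans (hdist x w₀).symm
    · exact (h.snd_eq x).trans (hdist x w₁).symm
  · intro a b
    obtain ⟨x, rfl⟩ := e.surjective a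
    obtain ⟨y, rfl⟩ := e.surjective b
    obtain ⟨p, hp⟩ := (e.connected_iff.1 h.connected).exists_walk_length_eq_dist (e x) (e y)
    let ι : imageGraph φ →g strongPower (pathGraph (G.diam + 1)) 2 :=
      (SimpleGraph.Embedding.induce _).toHom
    apply le_antisymm
    · rw [hdist]
      obtain ⟨q, hq⟩ := (p.map ι).reachable.exists_walk_length_eq_dist
      -- The whole board is itself a king's graph, in which walks are no shorter than the
      -- chessboard distance.
      have hle : strongPower (pathGraph (G.diam + 1)) 2 ≤
          kingGraph (fun c => (c 0 : ℕ)) (fun c => (c 1 : ℕ)) :=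
        fun a b hab => strongPower_pathGraph_adj_iff.1 hab
      have := chebDist_le_length (q.mapLe hle)
      rw [Walk.length_mapLe, hq] at this
      exact this
    · have := dist_le (p.map ι)
      rw [Walk.length_map, hp] at this
      exact this

/-- A strong resolving set of a connected graph on a vertex with three neighbours has at least two
elements: relative to a single landmark the vertex and its neighbours have only three possible
distances, and vertices at equal distance are not resolved. -/
theorem two_le_strongDim (hG : G.Connected) {c a₁ a₂ a₃ : V} (h₁ : G.Adj c a₁) (h₂ : G.Adj c a₂)
    (h₃ : G.Adj c a₃) (h₁₂ : a₁ ≠ a₂) (h₁₃ : a₁ ≠ a₃) (h₂₃ : a₂ ≠ a₃) : 2 ≤ strongDim G := by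
  refine le_iInf₂ fun W hW => ?_
  by_contra! hlt
  have hW1 : W.Subsingleton := by
    rw [← Set.encard_le_one_iff_subsingleton]
    exact Order.le_of_lt_add_one (by rwa [one_add_one_eq_two])
  obtain ⟨w, hw, -⟩ := hW c a₁ h₁.ne
  have hne : ∀ u v, u ≠ v → G.dist w u ≠ G.dist w v := fun u v huv heq => by
    obtain ⟨w', hw', hr⟩ := hW u v huv
    obtain rfl := hW1 hw hw'
    have := hG.pos_dist_of_ne huv
    rcases (stronglyResolves_iff hG).1 hr with h | h <;>
      rw [G.dist_comm (u := u) (v := w), G.dist_comm (u := v) (v := w)] at h <;> omega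
  have hnear : ∀ a, G.Adj c a →
      G.dist w a = G.dist w c + 1 ∨ G.dist w a + 1 = G.dist w c := fun a ha => by
    have h1 : G.dist w a ≤ G.dist w c + G.dist c a := hG.dist_triangle
    have h2 : G.dist w c ≤ G.dist w a + G.dist a c := hG.dist_triangle
    rw [dist_eq_one_iff_adj.2 ha] at h1
    rw [dist_eq_one_iff_adj.2 ha.symm] at h2
    have := hne c a ha.ne
    omega
  have := hnear _ h₁
  have := hnear _ h₂
  have := hnear _ h₃
  have := hne _ _ h₁₂
  have := hne _ _ h₁₃
  have := hne _ _ h₂₃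
  omega

theorem two_le_thresholdStrongDim (hG : G.Connected) {c a₁ a₂ a₃ : V} (h₁ : G.Adj c a₁)
    (h₂ : G.Adj c a₂) (h₃ : G.Adj c a₃) (h₁₂ : a₁ ≠ a₂) (h₁₃ : a₁ ≠ a₃) (h₂₃ : a₂ ≠ a₃) :
    2 ≤ thresholdStrongDim G :=
  le_iInf₂ fun _ hH => two_le_strongDim (hG.mono hH) (hH h₁) (hH h₂) (hH h₃) h₁₂ h₁₃ h₂₃

end Coordinates

/-! ### An isometric ladder on the chessboard -/

section Ladder

/-- Three strands of points `(a, b)`, each parametrized by its height `b`: the left rail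
`a = b - d` rises from `(0, d)` to height `d + h`; the right rail `a = 1 + |b - (d - 1)|` starts at
`(d, 0)`, runs along the antidiagonal, turns at `(1, d - 1)` and rises to height `d + h - 1`; the
rungs `a = 1 + |b - d|`, for `lo ≤ b ≤ hi`, lie between the rails. Absolute values are sums of two
truncated differences. -/
def Ladder (d h lo hi : ℕ) (p : ℕ × ℕ) : Prop :=
  (d ≤ p.2 ∧ p.2 ≤ d + h ∧ p.1 = p.2 - d) ∨
  (p.2 + 1 ≤ d + h ∧ p.1 = 1 + ((p.2 + 1 - d) + (d - 1 - p.2))) ∨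
  (lo ≤ p.2 ∧ p.2 ≤ hi ∧ p.1 = 1 + ((p.2 - d) + (d - p.2)))

/-- The point `r` of the set `S` is a king move away from `p` and closer to `q`. -/
def IsStepTowards (S : ℕ × ℕ → Prop) (p q r : ℕ × ℕ) : Prop :=
  S r ∧ chebDist Prod.fst Prod.snd p r ≤ 1 ∧
    chebDist Prod.fst Prod.snd r q < chebDist Prod.fst Prod.snd p q

/-- To check a step, it is enough to exhibit a number `n` such that `r` is, and `p` is not, within
chessboard distance `n` of `q`. -/
theorem isStepTowards_of_le {S : ℕ × ℕ → Prop} {p q r : ℕ × ℕ} (n : ℕ) (hr : S r)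
    (h₁ : p.1 ≤ r.1 + 1 ∧ r.1 ≤ p.1 + 1 ∧ p.2 ≤ r.2 + 1 ∧ r.2 ≤ p.2 + 1)
    (h₂ : r.1 ≤ q.1 + n ∧ q.1 ≤ r.1 + n ∧ r.2 ≤ q.2 + n ∧ q.2 ≤ r.2 + n)
    (h₃ : p.1 ≤ q.1 + n → q.1 ≤ p.1 + n → p.2 ≤ q.2 + n → ¬ q.2 ≤ p.2 + n) :
    IsStepTowards S p q r := by
  refine ⟨hr, chebDist_le_iff.2 h₁, (chebDist_le_iff.2 h₂).trans_lt (lt_of_not_ge fun h => ?_)⟩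
  obtain ⟨h4, h5, h6, h7⟩ := chebDist_le_iff.1 h
  exact h₃ h4 h5 h6 h7

variable {d h lo hi : ℕ}

theorem Ladder.left {a b : ℕ} (h₁ : d ≤ b) (h₂ : b ≤ d + h) (h₃ : a = b - d) :
    Ladder d h lo hi (a, b) :=
  Or.inl ⟨h₁, h₂, h₃⟩

theorem Ladder.right {a b : ℕ} (h₁ : b + 1 ≤ d + h)
    (h₂ : a = 1 + ((b + 1 - d) + (d - 1 - b))) : Ladder d h lo hi (a, b) :=
  Or.inr (Or.inl ⟨h₁, h₂⟩)

theorem Ladder.rung {a b : ℕ} (h₁ : lo ≤ b) (h₂ : b ≤ hi) (h₃ : a = 1 + ((b - d) + (d - b))) :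
    Ladder d h lo hi (a, b) :=
  Or.inr (Or.inr ⟨h₁, h₂, h₃⟩)

/-- Of two points of the ladder one can be moved closer to the other. The bounds on `lo` and `hi`
matter: rungs that only began above the top of the right rail, or did not reach above its
turning point, would leave a gap. -/
theorem Ladder.exists_step (hd : 1 ≤ d) (hlo : lo + 1 ≤ d + h) (hhi : d ≤ hi)
    {p q : ℕ × ℕ} (hp : Ladder d h lo hi p) (hq : Ladder d h lo hi q) (hpq : p ≠ q) :
    (∃ r, IsStepTowards (Ladder d h lo hi) p q r) ∨
      ∃ r, IsStepTowards (Ladder d h lo hi) q p r := by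
  -- Two points on one strand: move along the strand.
  have same : ∀ a b a' b' : ℕ, b < b' →
      ((d ≤ b ∧ b' ≤ d + h ∧ a = b - d ∧ a' = b' - d) ∨
      (b' + 1 ≤ d + h ∧ a = 1 + ((b + 1 - d) + (d - 1 - b)) ∧
        a' = 1 + ((b' + 1 - d) + (d - 1 - b'))) ∨
      (lo ≤ b ∧ b' ≤ hi ∧ a = 1 + ((b - d) + (d - b)) ∧ a' = 1 + ((b' - d) + (d - b')))) →
      ∃ r, IsStepTowards (Ladder d h lo hi) (a, b) (a', b') r := by
    rintro a b a' b' hlt (H | H | H)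
    · exact ⟨(b + 1 - d, b + 1), isStepTowards_of_le (b' - b - 1)
        (.left (by omega) (by omega) (by omega)) (by simp only; omega) (by simp only; omega)
        (by simp only; omega)⟩
    · exact ⟨(1 + ((b + 2 - d) + (d - 2 - b)), b + 1), isStepTowards_of_le (b' - b - 1)
        (.right (by omega) (by omega)) (by simp only; omega) (by simp only; omega)
        (by simp only; omega)⟩
    · exact ⟨(1 + ((b + 1 - d) + (d - 1 - b)), b + 1), isStepTowards_of_le (b' - b - 1)
        (.rung (by omega) (by omega) (by omega)) (by simp only; omega) (by simp only; omega)
        (by simp only; omega)⟩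
  -- One point on each rail: cross over to the right rail, or first descend on the left rail if the
  -- other point is lower by at least two.
  have leftRight : ∀ a b a' b' : ℕ, (d ≤ b ∧ b ≤ d + h ∧ a = b - d) →
      (b' + 1 ≤ d + h ∧ a' = 1 + ((b' + 1 - d) + (d - 1 - b'))) →
      ∃ r, IsStepTowards (Ladder d h lo hi) (a, b) (a', b') r := by
    intro a b a' b' H H'
    by_cases h1 : b' + 2 ≤ b ∧ d < b
    · exact ⟨(b - 1 - d, b - 1), isStepTowards_of_le (b - b' - 1)
        (.left (by omega) (by omega) (by omega)) (by simp only; omega) (by simp only; omega)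
        (by simp only; omega)⟩
    · exact ⟨(b - d + 1, b - 1), isStepTowards_of_le (if b ≤ b' then b' - b + 1 else b - 1 - b')
        (.right (by omega) (by omega)) (by simp only; omega)
        (by simp only; split_ifs <;> omega) (by simp only; split_ifs <;> omega)⟩
  -- One point on the left rail, the other one on the rungs.
  have leftRung : ∀ a b a' b' : ℕ, (d ≤ b ∧ b ≤ d + h ∧ a = b - d) →
      (lo ≤ b' ∧ b' ≤ hi ∧ a' = 1 + ((b' - d) + (d - b'))) →
      ∃ r, IsStepTowards (Ladder d h lo hi) (a, b) (a', b') r := by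
    intro a b a' b' H H'
    by_cases h1 : b ≤ b'
    · by_cases h2 : b < d + h ∧ b < b'
      · exact ⟨(b + 1 - d, b + 1), isStepTowards_of_le (b' - b)
          (.left (by omega) (by omega) (by omega)) (by simp only; omega) (by simp only; omega)
          (by simp only; omega)⟩
      · exact ⟨(b - d + 1, b), isStepTowards_of_le (b' - b)
          (.rung (by omega) (by omega) (by omega)) (by simp only; omega) (by simp only; omega)
          (by simp only; omega)⟩
    · by_cases h2 : b' < d
      · exact ⟨(b - d + 1, b - 1), isStepTowards_of_le (if b = d then b - b' else b - b' - 1)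
          (.right (by omega) (by omega)) (by simp only; omega)
          (by simp only; split_ifs <;> omega) (by simp only; split_ifs <;> omega)⟩
      · by_cases h3 : b = b' + 1
        · exact ⟨(a', b'), isStepTowards_of_le 0
            (.rung (by omega) (by omega) (by omega)) (by simp only; omega) (by simp only; omega)
            (by simp only; omega)⟩
        · exact ⟨(b - 1 - d, b - 1), isStepTowards_of_le (b - b' - 1)
            (.left (by omega) (by omega) (by omega)) (by simp only; omega) (by simp only; omega)
            (by simp only; omega)⟩
  -- One point on the rungs, the other one on the right rail.
  have rungRight : ∀ a b a' b' : ℕ, (lo ≤ b ∧ b ≤ hi ∧ a = 1 + ((b - d) + (d - b))) →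
      (b' + 1 ≤ d + h ∧ a' = 1 + ((b' + 1 - d) + (d - 1 - b'))) →
      ∃ r, IsStepTowards (Ladder d h lo hi) (a, b) (a', b') r := by
    intro a b a' b' H H'
    by_cases h1 : b' < b
    · by_cases h2 : b ≤ d + h
      · exact ⟨(a, b - 1), isStepTowards_of_le (b - 1 - b')
          (.right (by omega) (by omega)) (by simp only; omega) (by simp only; omega)
          (by simp only; omega)⟩
      · exact ⟨(b - d, b - 1), isStepTowards_of_le (b - 1 - b')
          (.rung (by omega) (by omega) (by omega)) (by simp only; omega) (by simp only; omega)
          (by simp only; omega)⟩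
    · by_cases h2 : b' + 1 ≤ d ∨ d ≤ b ∨ b' = b
      · exact ⟨(1 + ((b + 1 - d) + (d - 1 - b)), b), isStepTowards_of_le (b' - b)
          (.right (by omega) (by omega)) (by simp only; omega) (by simp only; omega)
          (by simp only; omega)⟩
      · by_cases h3 : b + 1 = d
        · exact ⟨(2, d), isStepTowards_of_le (b' - b - 1)
            (.right (by omega) (by omega)) (by simp only; omega) (by simp only; omega)
            (by simp only; omega)⟩
        · exact ⟨(d - b, b + 1), isStepTowards_of_le (b' - b - 1)
            (.rung (by omega) (by omega) (by omega)) (by simp only; omega) (by simp only; omega)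
            (by simp only; omega)⟩
  obtain ⟨a, b⟩ := p
  obtain ⟨a', b'⟩ := q
  have hne : a = a' → b ≠ b' := fun h1 h2 => hpq (by rw [h1, h2])
  unfold Ladder at hp hq
  simp only at hp hq
  rcases hp with hp | hp | hp <;> rcases hq with hq | hq | hq
  · rcases Nat.lt_or_ge b b' with hlt | hge
    · exact Or.inl (same _ _ _ _ hlt (by omega))
    · exact Or.inr (same _ _ _ _ (by omega) (by omega))
  · exact Or.inl (leftRight _ _ _ _ hp hq)
  · exact Or.inl (leftRung _ _ _ _ hp hq)
  · exact Or.inr (leftRight _ _ _ _ hq hp)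
  · rcases Nat.lt_or_ge b b' with hlt | hge
    · exact Or.inl (same _ _ _ _ hlt (by omega))
    · exact Or.inr (same _ _ _ _ (by omega) (by omega))
  · exact Or.inr (rungRight _ _ _ _ hq hp)
  · exact Or.inr (leftRung _ _ _ _ hq hp)
  · exact Or.inl (rungRight _ _ _ _ hp hq)
  · rcases Nat.lt_or_ge b b' with hlt | hge
    · exact Or.inl (same _ _ _ _ hlt (by omega))
    · exact Or.inr (same _ _ _ _ (by omega) (by omega))

end Ladder

/-! ### Placing the four-leaf tree on the ladder -/

section Placement

variable {k₁ k₂ k₃ k₄ k₅ : ℕ}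

/-- First coordinate of the vertices of the four-leaf tree on the ladder whose left rail starts at
height `d` and rises to height `d + h`. -/
def ladderFst (k₁ k₂ k₄ d h M : ℕ) {k₃ k₅ : ℕ} : FourLeafVertex k₁ k₂ k₃ k₄ k₅ → ℕ
  | .v i => if k₄ + i ≤ h then k₄ + i
      else 1 + ((k₂ + (k₁ - 1 - i) + 1 - d) + (d - 1 - (k₂ + (k₁ - 1 - i))))
  | .u j => 1 + ((k₂ - (j + 1) + 1 - d) + (d - 1 - (k₂ - (j + 1))))
  | .x j => 1 + ((d + M - (j + 2) - d) + (d - (d + M - (j + 2))))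
  | .y j => k₄ - (j + 1)
  | .z j => 1 + ((d + M - 1 + j - d) + (d - (d + M - 1 + j)))

/-- Second coordinate (height) of the vertices of the four-leaf tree on the ladder: the path `y`
rises on the left rail, `v` continues up to the top and comes back down on the right rail, `u`
descends the rest of the right rail, and on the rungs `x` descends from height
`d + M - 2` and `z` rises from height `d + M - 1`. -/
def ladderSnd (k₁ k₂ k₄ d h M : ℕ) {k₃ k₅ : ℕ} : FourLeafVertex k₁ k₂ k₃ k₄ k₅ → ℕ
  | .v i => if k₄ + i ≤ h then d + k₄ + i else k₂ + (k₁ - 1 - i)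
  | .u j => k₂ - (j + 1)
  | .x j => d + M - (j + 2)
  | .y j => d + k₄ - (j + 1)
  | .z j => d + M - 1 + j

variable {d r h M : ℕ}

/-- To prove a symmetric relation for adjacent vertices of the four-leaf tree, it is enough to treat
the nine kinds of edges in one direction. -/
theorem fourLeafTree_adj_induction {P : FourLeafVertex k₁ k₂ k₃ k₄ k₅ →
    FourLeafVertex k₁ k₂ k₃ k₄ k₅ → Prop} (symm : ∀ a b, P a b → P b a)
    (vv : ∀ i j : Fin k₁, (i : ℕ) + 1 = j → P (.v i) (.v j))
    (uu : ∀ i j : Fin k₂, (i : ℕ) + 1 = j → P (.u i) (.u j))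
    (xx : ∀ i j : Fin k₃, (i : ℕ) + 1 = j → P (.x i) (.x j))
    (yy : ∀ i j : Fin k₄, (i : ℕ) + 1 = j → P (.y i) (.y j))
    (zz : ∀ i j : Fin k₅, (i : ℕ) + 1 = j → P (.z i) (.z j))
    (vy : ∀ (i : Fin k₁) (j : Fin k₄), (i : ℕ) = 0 → (j : ℕ) = 0 → P (.v i) (.y j))
    (vz : ∀ (i : Fin k₁) (j : Fin k₅), (i : ℕ) = 0 → (j : ℕ) = 0 → P (.v i) (.z j))
    (vu : ∀ (i : Fin k₁) (j : Fin k₂), (i : ℕ) + 1 = k₁ → (j : ℕ) = 0 → P (.v i) (.u j))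
    (vx : ∀ (i : Fin k₁) (j : Fin k₃), (i : ℕ) + 1 = k₁ → (j : ℕ) = 0 → P (.v i) (.x j))
    {a b : FourLeafVertex k₁ k₂ k₃ k₄ k₅} (hab : (fourLeafTree k₁ k₂ k₃ k₄ k₅).Adj a b) :
    P a b := by
  rw [fourLeafTree, fromRel_adj] at hab
  obtain ⟨-, hab | hab⟩ := hab
  · cases a <;> cases b <;> simp only at hab
    exacts [vv _ _ hab, vu _ _ hab.1 hab.2, vx _ _ hab.1 hab.2, vy _ _ hab.1 hab.2,
      vz _ _ hab.1 hab.2, uu _ _ hab, xx _ _ hab, yy _ _ hab, zz _ _ hab]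
  · apply symm
    cases a <;> cases b <;> simp only at hab
    exacts [vv _ _ hab, vu _ _ hab.1 hab.2, uu _ _ hab, vx _ _ hab.1 hab.2, xx _ _ hab,
      vy _ _ hab.1 hab.2, yy _ _ hab, vz _ _ hab.1 hab.2, zz _ _ hab]

/-- Numerical conditions under which the four-leaf tree fits on the ladder. The right rail has `r`
points of the path `u` from its turning point upwards, where `r` is `k₄` or `k₄ - 1` according to
the parity of `k₁`, so that `v` can go up one rail and down the other. If `k₁ = 1`, then `v` is the
top of the right rail. -/
structure LadderFits (k₁ k₂ k₄ d r h M : ℕ) : Prop where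
  tail : d + r = k₂ + 1
  up_down : k₁ + k₄ + r = 2 * h + 2
  parity : r = k₄ ∨ r + 1 = k₄
  top : (h + 1 = k₄ ∧ r = h ∧ M = k₄) ∨ (k₄ ≤ h ∧ M = k₄ + 1)

theorem exists_ladderFits (h₁ : 1 ≤ k₁) (h₄ : 1 ≤ k₄) (h₄₂ : k₄ ≤ k₂) :
    ∃ d r h M, LadderFits k₁ k₂ k₄ d r h M := by
  rcases Nat.even_or_odd' k₁ with ⟨e, rfl | rfl⟩
  · exact ⟨k₂ + 1 - k₄, k₄, k₄ + e - 1, k₄ + 1, by omega, by omega, by omega, by omega⟩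
  · rcases Nat.eq_zero_or_pos e with rfl | he
    · exact ⟨k₂ + 2 - k₄, k₄ - 1, k₄ - 1, k₄, by omega, by omega, by omega, by omega⟩
    · exact ⟨k₂ + 2 - k₄, k₄ - 1, k₄ + e - 1, k₄ + 1, by omega, by omega, by omega, by omega⟩

theorem LadderFits.ladder (H : LadderFits k₁ k₂ k₄ d r h M) (h₃ : 1 ≤ k₃) (h₅ : 1 ≤ k₅)
    (w : FourLeafVertex k₁ k₂ k₃ k₄ k₅) :
    Ladder d h (d + M - (k₃ + 1)) (d + M + k₅ - 2)
      (ladderFst k₁ k₂ k₄ d h M w, ladderSnd k₁ k₂ k₄ d h M w) := by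
  obtain ⟨H1, H2, H3, H4⟩ := H
  rcases w with ⟨i, hi⟩ | ⟨i, hi⟩ | ⟨i, hi⟩ | ⟨i, hi⟩ | ⟨i, hi⟩ <;> simp only [ladderFst, ladderSnd]
  · split_ifs with hih
    · exact .left (by omega) (by omega) (by omega)
    · exact .right (by omega) (by omega)
  · exact .right (by omega) (by omega)
  · exact .rung (by omega) (by omega) (by omega)
  · exact .left (by omega) (by omega) (by omega)
  · exact .rung (by omega) (by omega) (by omega)

theorem LadderFits.exists_of_ladder (H : LadderFits k₁ k₂ k₄ d r h M) (h₁ : 1 ≤ k₁)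
    (h₃₂ : k₃ ≤ k₂) {p : ℕ × ℕ}
    (hp : Ladder d h (d + M - (k₃ + 1)) (d + M + k₅ - 2) p) :
    ∃ w : FourLeafVertex k₁ k₂ k₃ k₄ k₅,
      ladderFst k₁ k₂ k₄ d h M w = p.1 ∧ ladderSnd k₁ k₂ k₄ d h M w = p.2 := by
  obtain ⟨H1, H2, H3, H4⟩ := H
  obtain ⟨a, b⟩ := p
  unfold Ladder at hp
  simp only at hp ⊢
  rcases hp with hp | hp | hp
  · by_cases hb : b < d + k₄
    · refine ⟨.y ⟨d + k₄ - 1 - b, by omega⟩, ?_⟩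
      simp only [ladderFst, ladderSnd]
      omega
    · refine ⟨.v ⟨b - d - k₄, by omega⟩, ?_⟩
      simp only [ladderFst, ladderSnd]
      rw [if_pos (by omega), if_pos (by omega)]
      omega
  · by_cases hb : b < k₂
    · refine ⟨.u ⟨k₂ - 1 - b, by omega⟩, ?_⟩
      simp only [ladderFst, ladderSnd]
      omega
    · refine ⟨.v ⟨k₁ - 1 - (b - k₂), by omega⟩, ?_⟩
      simp only [ladderFst, ladderSnd]
      rw [if_neg (by omega), if_neg (by omega)]
      omega
  · by_cases hb : b + 2 ≤ d + M
    · refine ⟨.x ⟨d + M - 2 - b, by omega⟩, ?_⟩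
      simp only [ladderFst, ladderSnd]
      omega
    · refine ⟨.z ⟨b + 1 - d - M, by omega⟩, ?_⟩
      simp only [ladderFst, ladderSnd]
      omega

theorem LadderFits.eq_of_coords (H : LadderFits k₁ k₂ k₄ d r h M) (h₄₂ : k₄ ≤ k₂) (h₃₂ : k₃ ≤ k₂)
    (w w' : FourLeafVertex k₁ k₂ k₃ k₄ k₅)
    (hf : ladderFst k₁ k₂ k₄ d h M w = ladderFst k₁ k₂ k₄ d h M w')
    (hs : ladderSnd k₁ k₂ k₄ d h M w = ladderSnd k₁ k₂ k₄ d h M w') : w = w' := by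
  obtain ⟨H1, H2, H3, H4⟩ := H
  rcases w with ⟨i, hi⟩ | ⟨i, hi⟩ | ⟨i, hi⟩ | ⟨i, hi⟩ | ⟨i, hi⟩ <;>
    rcases w' with ⟨j, hj⟩ | ⟨j, hj⟩ | ⟨j, hj⟩ | ⟨j, hj⟩ | ⟨j, hj⟩ <;>
    simp only [ladderFst, ladderSnd] at hf hs <;>
    simp only [FourLeafVertex.v.injEq, FourLeafVertex.u.injEq, FourLeafVertex.x.injEq,
      FourLeafVertex.y.injEq, FourLeafVertex.z.injEq, Fin.mk.injEq, reduceCtorEq] <;>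
    first | omega | (split_ifs at hf hs <;> omega)

theorem LadderFits.adj_le (H : LadderFits k₁ k₂ k₄ d r h M) (h₄₂ : k₄ ≤ k₂) (h₃₂ : k₃ ≤ k₂)
    (w w' : FourLeafVertex k₁ k₂ k₃ k₄ k₅) (hw : (fourLeafTree k₁ k₂ k₃ k₄ k₅).Adj w w') :
    chebDist (ladderFst k₁ k₂ k₄ d h M) (ladderSnd k₁ k₂ k₄ d h M) w w' ≤ 1 := by
  obtain ⟨H1, H2, H3, H4⟩ := H
  refine fourLeafTree_adj_induction (P := fun a b => chebDist (ladderFst k₁ k₂ k₄ d h M)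
    (ladderSnd k₁ k₂ k₄ d h M) a b ≤ 1) (fun a b hab => by rwa [chebDist_comm])
    (fun i j hij => ?_) (fun i j hij => ?_) (fun i j hij => ?_) (fun i j hij => ?_)
    (fun i j hij => ?_) (fun i j hi hj => ?_) (fun i j hi hj => ?_) (fun i j hi hj => ?_)
    (fun i j hi hj => ?_) hw <;>
    rw [chebDist_le_iff] <;> simp only [ladderFst, ladderSnd] <;>
    first | omega | (split_ifs <;> omega)

/-- The rungs of this ladder start at height `d + M - (k₃ + 1)`, which is positive because
`k₃ ≤ k₂`. Hence no rung is farther from the landmark `(d, 0)` than its second coordinate says. -/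
theorem LadderFits.isResolvedPlacement (H : LadderFits k₁ k₂ k₄ d r h M) (h₁ : 1 ≤ k₁)
    (h₂ : 1 ≤ k₂) (h₃ : 1 ≤ k₃) (h₄ : 1 ≤ k₄) (h₅ : 1 ≤ k₅) (h₄₂ : k₄ ≤ k₂) (h₃₂ : k₃ ≤ k₂) :
    IsResolvedPlacement (fourLeafTree k₁ k₂ k₃ k₄ k₅) (.y ⟨k₄ - 1, by omega⟩)
      (.u ⟨k₂ - 1, by omega⟩) (ladderFst k₁ k₂ k₄ d h M) (ladderSnd k₁ k₂ k₄ d h M) := by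
  have hL := H.ladder h₃ h₅
  have hE := fun p => H.exists_of_ladder (k₅ := k₅) h₁ h₃₂ (p := p)
  have hI := H.eq_of_coords (k₅ := k₅) h₄₂ h₃₂
  have hA := H.adj_le (k₅ := k₅) h₄₂ h₃₂
  obtain ⟨H1, H2, H3, H4⟩ := H
  refine ⟨by simp, hI, hA, fun w => ?_, fun w => ?_, fun w w' hne => ?_⟩
  · have h0 : ladderFst k₁ k₂ k₄ d h M
        (.y ⟨k₄ - 1, by omega⟩ : FourLeafVertex k₁ k₂ k₃ k₄ k₅) = 0 := by
      simp only [ladderFst]; omega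
    have h0' : ladderSnd k₁ k₂ k₄ d h M
        (.y ⟨k₄ - 1, by omega⟩ : FourLeafVertex k₁ k₂ k₃ k₄ k₅) = d := by
      simp only [ladderSnd]; omega
    have hw := hL w
    unfold Ladder at hw
    simp only at hw
    rw [chebDist, h0, h0']
    omega
  · have h0 : ladderFst k₁ k₂ k₄ d h M
        (.u ⟨k₂ - 1, by omega⟩ : FourLeafVertex k₁ k₂ k₃ k₄ k₅) = d := by
      simp only [ladderFst]; omega
    have h0' : ladderSnd k₁ k₂ k₄ d h M
        (.u ⟨k₂ - 1, by omega⟩ : FourLeafVertex k₁ k₂ k₃ k₄ k₅) = 0 := by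
      simp only [ladderSnd]; omega
    have hw := hL w
    unfold Ladder at hw
    simp only at hw
    rw [chebDist, h0, h0']
    omega
  · rcases Ladder.exists_step (by omega) (by omega) (by omega) (hL w) (hL w')
      (fun h => hne (hI _ _ (congrArg Prod.fst h) (congrArg Prod.snd h))) with
      ⟨p, hp, hp1, hp2⟩ | ⟨p, hp, hp1, hp2⟩
    · obtain ⟨z, hz⟩ := hE p hp
      obtain rfl : (ladderFst k₁ k₂ k₄ d h M z, ladderSnd k₁ k₂ k₄ d h M z) = p :=
        Prod.ext hz.1 hz.2
      exact Or.inl ⟨z, hp1, hp2⟩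
    · obtain ⟨z, hz⟩ := hE p hp
      obtain rfl : (ladderFst k₁ k₂ k₄ d h M z, ladderSnd k₁ k₂ k₄ d h M z) = p :=
        Prod.ext hz.1 hz.2
      refine Or.inr ⟨z, hp1, ?_⟩
      rw [chebDist_comm, chebDist_comm (x := w)]
      exact hp2

end Placement

/-! ### Symmetries of the four-leaf tree -/

section Symmetries

variable {k₁ k₂ k₃ k₄ k₅ : ℕ}

/-- Exchange of the paths `u` and `x`. -/
def fourLeafSwapUX : FourLeafVertex k₁ k₂ k₃ k₄ k₅ → FourLeafVertex k₁ k₃ k₂ k₄ k₅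
  | .v i => .v i
  | .u i => .x i
  | .x i => .u i
  | .y i => .y i
  | .z i => .z i

/-- Reversal of the path `v`, exchanging the paths `u`, `x` with the paths `y`, `z`. -/
def fourLeafReverse : FourLeafVertex k₁ k₂ k₃ k₄ k₅ → FourLeafVertex k₁ k₄ k₅ k₂ k₃
  | .v i => .v i.rev
  | .u i => .y i
  | .x i => .z i
  | .y i => .u i
  | .z i => .x i

theorem fourLeafSwapUX_adj {a b : FourLeafVertex k₁ k₂ k₃ k₄ k₅}
    (hab : (fourLeafTree k₁ k₂ k₃ k₄ k₅).Adj a b) :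
    (fourLeafTree k₁ k₃ k₂ k₄ k₅).Adj (fourLeafSwapUX a) (fourLeafSwapUX b) := by
  refine fourLeafTree_adj_induction (P := fun a b => (fourLeafTree k₁ k₃ k₂ k₄ k₅).Adj
    (fourLeafSwapUX a) (fourLeafSwapUX b)) (fun a b hab => hab.symm)
    ?_ ?_ ?_ ?_ ?_ ?_ ?_ ?_ ?_ hab <;> intros <;>
    simp [fourLeafTree, fourLeafSwapUX, Fin.ext_iff] <;> omega

theorem fourLeafReverse_adj {a b : FourLeafVertex k₁ k₂ k₃ k₄ k₅}
    (hab : (fourLeafTree k₁ k₂ k₃ k₄ k₅).Adj a b) :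
    (fourLeafTree k₁ k₄ k₅ k₂ k₃).Adj (fourLeafReverse a) (fourLeafReverse b) := by
  refine fourLeafTree_adj_induction (P := fun a b => (fourLeafTree k₁ k₄ k₅ k₂ k₃).Adj
    (fourLeafReverse a) (fourLeafReverse b)) (fun a b hab => hab.symm)
    ?_ ?_ ?_ ?_ ?_ ?_ ?_ ?_ ?_ hab <;> intros <;>
    simp [fourLeafTree, fourLeafReverse, Fin.ext_iff, Fin.val_rev] <;> omega

theorem fourLeafSwapUX_swapUX (a : FourLeafVertex k₁ k₂ k₃ k₄ k₅) :
    fourLeafSwapUX (fourLeafSwapUX a) = a := by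
  cases a <;> rfl

theorem fourLeafReverse_reverse (a : FourLeafVertex k₁ k₂ k₃ k₄ k₅) :
    fourLeafReverse (fourLeafReverse a) = a := by
  cases a <;> simp [fourLeafReverse]

/-- `fourLeafSwapUX` as a graph isomorphism. -/
def fourLeafSwapUXIso (k₁ k₂ k₃ k₄ k₅ : ℕ) :
    fourLeafTree k₁ k₂ k₃ k₄ k₅ ≃g fourLeafTree k₁ k₃ k₂ k₄ k₅ where
  toFun := fourLeafSwapUX
  invFun := fourLeafSwapUX
  left_inv := fourLeafSwapUX_swapUX
  right_inv := fourLeafSwapUX_swapUX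
  map_rel_iff' := ⟨fun h => by simpa [fourLeafSwapUX_swapUX] using fourLeafSwapUX_adj h,
    fourLeafSwapUX_adj⟩

/-- `fourLeafReverse` as a graph isomorphism. -/
def fourLeafReverseIso (k₁ k₂ k₃ k₄ k₅ : ℕ) :
    fourLeafTree k₁ k₂ k₃ k₄ k₅ ≃g fourLeafTree k₁ k₄ k₅ k₂ k₃ where
  toFun := fourLeafReverse
  invFun := fourLeafReverse
  left_inv := fourLeafReverse_reverse
  right_inv := fourLeafReverse_reverse
  map_rel_iff' := ⟨fun h => by simpa [fourLeafReverse_reverse] using fourLeafReverse_adj h,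
    fourLeafReverse_adj⟩

/-- Reversal reduces the placement to the case `k₄ ≤ k₂`, in which the ladder has its tail on the
side of `u`. -/
theorem exists_isResolvedPlacement (h₁ : 1 ≤ k₁) (h₃ : 1 ≤ k₃) (h₃₂ : k₃ ≤ k₂) (h₅ : 1 ≤ k₅)
    (h₅₄ : k₅ ≤ k₄) (hy : k₄ - 1 < k₄) (hu : k₂ - 1 < k₂) :
    ∃ f g, IsResolvedPlacement (fourLeafTree k₁ k₂ k₃ k₄ k₅) (.y ⟨k₄ - 1, hy⟩)
      (.u ⟨k₂ - 1, hu⟩) f g := by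
  rcases le_total k₄ k₂ with h | h
  · obtain ⟨d, r, t, M, H⟩ := exists_ladderFits h₁ (h₅.trans h₅₄) h
    exact ⟨_, _, H.isResolvedPlacement h₁ (h₃.trans h₃₂) h₃ (h₅.trans h₅₄) h₅ h h₃₂⟩
  · obtain ⟨d, r, t, M, H⟩ := exists_ladderFits h₁ (h₃.trans h₃₂) h
    exact ⟨_, _, ((H.isResolvedPlacement h₁ (h₅.trans h₅₄) h₅ (h₃.trans h₃₂) h₃ h h₅₄).comp_iso
      (fourLeafReverseIso k₁ k₂ k₃ k₄ k₅)).symm⟩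

theorem fourLeafTree_preconnected (h₁ : 1 ≤ k₁) :
    (fourLeafTree k₁ k₂ k₃ k₄ k₅).Preconnected := by
  have hv : ∀ (n : ℕ) (hn : n < k₁),
      (fourLeafTree k₁ k₂ k₃ k₄ k₅).Reachable (.v ⟨0, h₁⟩) (.v ⟨n, hn⟩) := by
    intro n
    induction n with
    | zero => intro _; rfl
    | succ n ih =>
      exact fun hn => (ih (by omega)).trans (Adj.reachable (by simp [fourLeafTree]))
  have hroot : ∀ a, (fourLeafTree k₁ k₂ k₃ k₄ k₅).Reachable (.v ⟨0, h₁⟩) a := by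
    rintro (⟨n, hn⟩ | ⟨n, hn⟩ | ⟨n, hn⟩ | ⟨n, hn⟩ | ⟨n, hn⟩)
    · exact hv n hn
    · induction n with
      | zero =>
        exact (hv (k₁ - 1) (by omega)).trans (Adj.reachable (by simp [fourLeafTree]; omega))
      | succ n ih => exact (ih (by omega)).trans (Adj.reachable (by simp [fourLeafTree]))
    · induction n with
      | zero =>
        exact (hv (k₁ - 1) (by omega)).trans (Adj.reachable (by simp [fourLeafTree]; omega))
      | succ n ih => exact (ih (by omega)).trans (Adj.reachable (by simp [fourLeafTree]))
    · induction n with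
      | zero => exact Adj.reachable (by simp [fourLeafTree])
      | succ n ih => exact (ih (by omega)).trans (Adj.reachable (by simp [fourLeafTree]))
    · induction n with
      | zero => exact Adj.reachable (by simp [fourLeafTree])
      | succ n ih => exact (ih (by omega)).trans (Adj.reachable (by simp [fourLeafTree]))
  exact fun a b => (hroot a).symm.trans (hroot b)

end Symmetries

/-! ### Trees with four leaves -/

section Classification

variable {V : Type*} {T : SimpleGraph V}

/-- A bijective homomorphism from a connected graph to an acyclic graph is an isomorphism: an edge
of the target is the only path between its ends, hence the image of a path of length one. -/
theorem nonempty_iso_of_bijective_hom {W : Type*} {F : SimpleGraph W} (hF : F.Preconnected)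
    (hT : T.IsAcyclic) (φ : F →g T) (hφ : Function.Bijective φ) : Nonempty (T ≃g F) := by
  refine ⟨RelIso.symm ⟨Equiv.ofBijective φ hφ, fun {a b} => ⟨fun hab => ?_, φ.map_adj⟩⟩⟩
  have hab' : T.Adj (φ a) (φ b) := hab
  obtain ⟨p, hp⟩ := (hF a b).exists_isPath
  have h := (hT.subsingleton_path _ _).elim ⟨p.map φ, Walk.IsPath.map hφ.1 hp⟩ (Path.singleton hab')
  have hl := congrArg (fun q => Walk.length q.1) h
  simp only [Walk.length_map, Path.singleton] at hl
  exact Walk.adj_of_length_eq_one (p := p) (by simpa using hl)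

/-- A geodesic from `r` to `l` as a sequence of vertices, of which only the terms up to `T.dist r l`
matter; in a tree it passes through every vertex between `r` and `l`. -/
theorem exists_geodesic (hT : T.IsTree) (r l : V) :
    ∃ g : ℕ → V, g 0 = r ∧ g (T.dist r l) = l ∧ (∀ i < T.dist r l, T.Adj (g i) (g (i + 1))) ∧
      (∀ i ≤ T.dist r l, T.dist r (g i) = i) ∧
      ∀ w, T.dist r l = T.dist r w + T.dist w l → g (T.dist r w) = w := by
  obtain ⟨p, hp⟩ := hT.1.exists_walk_length_eq_dist r l
  have hdist : ∀ i ≤ T.dist r l, T.dist r (p.getVert i) = i := fun i hi => by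
    have h1 := dist_le (p.take i)
    have h2 := dist_le (p.drop i)
    have h3 : T.dist r l ≤ T.dist r (p.getVert i) + T.dist (p.getVert i) l := hT.1.dist_triangle
    rw [Walk.take_length] at h1
    rw [Walk.drop_length] at h2
    omega
  refine ⟨p.getVert, p.getVert_zero, hp ▸ p.getVert_length,
    fun i hi => p.adj_getVert_succ (hp ▸ hi), hdist, fun w hw => ?_⟩
  obtain ⟨q, hq, -, hwq⟩ := (exists_shortest_path_mem_support_iff hT.1).2 hw
  obtain rfl := (hT.existsUnique_path r l).unique hq (p.isPath_of_length_eq_dist hp)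
  obtain ⟨i, rfl, hi⟩ := Walk.mem_support_iff_exists_getVert.1 hwq
  rw [hdist i (hp ▸ hi)]

/-- The geodesics from a leaf `r` to two other leaves agree up to a branching level `m`, which lies
strictly between the ends. -/
theorem exists_branching_level (hT : T.IsTree) {r l l' : V} (hr : r ∈ leaves T)
    (hl : l ∈ leaves T) (hl' : l' ∈ leaves T) (hrl : r ≠ l) (hrl' : r ≠ l') (hll' : l ≠ l')
    {g g' : ℕ → V} (h0 : g 0 = r) (h0' : g' 0 = r) (hend : g (T.dist r l) = l)
    (hend' : g' (T.dist r l') = l')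
    (hadj : ∀ i < T.dist r l, T.Adj (g i) (g (i + 1)))
    (hadj' : ∀ i < T.dist r l', T.Adj (g' i) (g' (i + 1)))
    (hd : ∀ i ≤ T.dist r l, T.dist r (g i) = i) (hd' : ∀ i ≤ T.dist r l', T.dist r (g' i) = i) :
    ∃ m, 1 ≤ m ∧ m < T.dist r l ∧ m < T.dist r l' ∧
      ∀ i ≤ T.dist r l, i ≤ T.dist r l' → (g i = g' i ↔ i ≤ m) := by
  classical
  have hpos := hT.1.pos_dist_of_ne hrl
  have hpos' := hT.1.pos_dist_of_ne hrl'
  let P : ℕ → Prop := fun i => i ≤ T.dist r l' ∧ g i = g' i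
  have hdown : ∀ i j, i ≤ j → j ≤ T.dist r l → P j → P i := by
    intro i j hij
    induction j, hij using Nat.le_induction with
    | base => exact fun _ h => h
    | succ j _ ih =>
      rintro hj ⟨hj', hg⟩
      refine ih (by omega) ⟨by omega, ?_⟩
      have ha := hadj j (by omega)
      have ha' := hadj' j (by omega)
      rw [← hg] at ha'
      exact eq_of_adj_of_dist_succ hT ha ha' (by rw [hd _ hj, hd _ (by omega)])
        (by rw [hd _ hj, hd' _ (by omega)])
  have h1 : P 1 := ⟨hpos', eq_of_adj_of_mem_leaves hr (h0 ▸ hadj 0 hpos) (h0' ▸ hadj' 0 hpos')⟩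
  have hm : P (Nat.findGreatest P (T.dist r l)) := Nat.findGreatest_spec hpos h1
  have hmle := Nat.findGreatest_le (P := P) (T.dist r l)
  have hm1 := Nat.le_findGreatest hpos h1
  refine ⟨Nat.findGreatest P (T.dist r l), hm1, ?_, ?_, fun i hi hi' => ⟨fun h => ?_, fun h => ?_⟩⟩
  -- If the geodesics agreed up to an end, this leaf would be an interior vertex of the other one.
  · refine lt_of_le_of_ne hmle fun h => ?_
    rw [h] at hm
    obtain ⟨hle, hg⟩ := hm
    rw [hend] at hg
    have hlt : T.dist r l < T.dist r l' :=
      lt_of_le_of_ne hle fun h => hll' (by rw [hg, h, hend'])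
    have ha := hadj' (T.dist r l - 1) (by omega)
    rw [Nat.sub_add_cancel hpos, ← hg] at ha
    have hb := hadj' (T.dist r l) hlt
    rw [← hg] at hb
    have := congrArg (T.dist r) (eq_of_adj_of_mem_leaves hl ha.symm hb)
    rw [hd' _ (by omega), hd' _ (by omega)] at this
    omega
  · refine lt_of_le_of_ne hm.1 fun h => ?_
    rw [h] at hm hmle
    obtain ⟨hle, hg⟩ := hm
    rw [hend'] at hg
    have hlt : T.dist r l' < T.dist r l :=
      lt_of_le_of_ne hmle fun h => hll' (by rw [← hg, h, hend])
    have ha := hadj (T.dist r l' - 1) (by omega)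
    rw [Nat.sub_add_cancel hpos', hg] at ha
    have hb := hadj (T.dist r l') hlt
    rw [hg] at hb
    have := congrArg (T.dist r) (eq_of_adj_of_mem_leaves hl' ha.symm hb)
    rw [hd _ (by omega), hd _ (by omega)] at this
    omega
  · exact Nat.le_findGreatest hi ⟨hi', h⟩
  · exact (hdown i _ h hmle hm).2

/-- A tree covered by three geodesics `gU`, `gX`, `gZ` from a root `r`, of which the first two
separate at level `t` and the third leaves them at level `s ≤ t`, is a four-leaf tree. -/
theorem nonempty_iso_of_geodesics (hT : T.IsTree) {r : V} {gU gX gZ : ℕ → V} {s t dU dX dZ : ℕ}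
    (hs : 1 ≤ s) (hst : s ≤ t) (htU : t < dU) (htX : t < dX) (hsZ : s < dZ)
    (haU : ∀ i < dU, T.Adj (gU i) (gU (i + 1))) (haX : ∀ i < dX, T.Adj (gX i) (gX (i + 1)))
    (haZ : ∀ i < dZ, T.Adj (gZ i) (gZ (i + 1)))
    (hdU : ∀ i ≤ dU, T.dist r (gU i) = i) (hdX : ∀ i ≤ dX, T.dist r (gX i) = i)
    (hdZ : ∀ i ≤ dZ, T.dist r (gZ i) = i)
    (hUX : ∀ i ≤ dU, i ≤ dX → (gU i = gX i ↔ i ≤ t))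
    (hUZ : ∀ i ≤ dU, i ≤ dZ → (gU i = gZ i ↔ i ≤ s))
    (hXZ : ∀ i ≤ dX, i ≤ dZ → (gX i = gZ i ↔ i ≤ s))
    (hcover : ∀ w, (∃ i ≤ dU, gU i = w) ∨ (∃ i ≤ dX, gX i = w) ∨ (∃ i ≤ dZ, gZ i = w)) :
    ∃ k₁ k₂ k₃ k₄ k₅ : ℕ, 1 ≤ k₁ ∧ 1 ≤ k₂ ∧ 1 ≤ k₃ ∧ 1 ≤ k₄ ∧ 1 ≤ k₅ ∧
      Nonempty (T ≃g fourLeafTree k₁ k₂ k₃ k₄ k₅) := by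
  refine ⟨t - s + 1, dU - t, dX - t, s, dZ - s, by omega, by omega, by omega, hs, by omega, ?_⟩
  let φ : FourLeafVertex (t - s + 1) (dU - t) (dX - t) s (dZ - s) → V := fun
    | .v i => gU (s + i)
    | .u i => gU (t + 1 + i)
    | .x i => gX (t + 1 + i)
    | .y i => gU (s - 1 - i)
    | .z i => gZ (s + 1 + i)
  have eUU : ∀ i j, i ≤ dU → j ≤ dU → gU i = gU j → i = j := fun i j hi hj h => by
    rw [← hdU i hi, ← hdU j hj, h]
  have eXX : ∀ i j, i ≤ dX → j ≤ dX → gX i = gX j → i = j := fun i j hi hj h => by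
    rw [← hdX i hi, ← hdX j hj, h]
  have eZZ : ∀ i j, i ≤ dZ → j ≤ dZ → gZ i = gZ j → i = j := fun i j hi hj h => by
    rw [← hdZ i hi, ← hdZ j hj, h]
  have eUX : ∀ i j, i ≤ dU → j ≤ dX → gU i = gX j → i = j ∧ i ≤ t := fun i j hi hj h => by
    obtain rfl : i = j := by rw [← hdU i hi, ← hdX j hj, h]
    exact ⟨rfl, (hUX i hi hj).1 h⟩
  have eUZ : ∀ i j, i ≤ dU → j ≤ dZ → gU i = gZ j → i = j ∧ i ≤ s := fun i j hi hj h => by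
    obtain rfl : i = j := by rw [← hdU i hi, ← hdZ j hj, h]
    exact ⟨rfl, (hUZ i hi hj).1 h⟩
  have eXZ : ∀ i j, i ≤ dX → j ≤ dZ → gX i = gZ j → i = j ∧ i ≤ s := fun i j hi hj h => by
    obtain rfl : i = j := by rw [← hdX i hi, ← hdZ j hj, h]
    exact ⟨rfl, (hXZ i hi hj).1 h⟩
  have step : ∀ {g : ℕ → V} {d i j : ℕ}, (∀ i < d, T.Adj (g i) (g (i + 1))) → i < d → j = i + 1 →
      T.Adj (g i) (g j) := by
    rintro g d i _ hg hi rfl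
    exact hg i hi
  refine nonempty_iso_of_bijective_hom (fourLeafTree_preconnected (by omega)) hT.2
    ⟨φ, fun {a b} hab => ?_⟩ ⟨?_, ?_⟩
  · refine fourLeafTree_adj_induction (P := fun a b => T.Adj (φ a) (φ b)) (fun a b h => h.symm)
      (fun i j hij => ?_) (fun i j hij => ?_) (fun i j hij => ?_) (fun i j hij => ?_)
      (fun i j hij => ?_) (fun i j hi hj => ?_) (fun i j hi hj => ?_) (fun i j hi hj => ?_)
      (fun i j hi hj => ?_) hab
    · exact step haU (by omega) (by omega)
    · exact step haU (by omega) (by omega)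
    · exact step haX (by omega) (by omega)
    · exact (step haU (by omega) (by omega)).symm
    · exact step haZ (by omega) (by omega)
    · exact (step haU (by omega) (by omega)).symm
    · change T.Adj (gU (s + i)) _
      rw [(hUZ (s + i) (by omega) (by omega)).2 (by omega)]
      exact step haZ (by omega) (by omega)
    · exact step haU (by omega) (by omega)
    · change T.Adj (gU (s + i)) _
      rw [(hUX (s + i) (by omega) (by omega)).2 (by omega)]
      exact step haX (by omega) (by omega)
  · intro a b hab
    change φ a = φ b at hab
    rcases a with ⟨i, hi⟩ | ⟨i, hi⟩ | ⟨i, hi⟩ | ⟨i, hi⟩ | ⟨i, hi⟩ <;>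
      rcases b with ⟨j, hj⟩ | ⟨j, hj⟩ | ⟨j, hj⟩ | ⟨j, hj⟩ | ⟨j, hj⟩ <;>
      simp only [φ] at hab <;>
      simp only [FourLeafVertex.v.injEq, FourLeafVertex.u.injEq, FourLeafVertex.x.injEq,
        FourLeafVertex.y.injEq, FourLeafVertex.z.injEq, Fin.mk.injEq, reduceCtorEq] <;>
      first
      | (have := eUU _ _ (by omega) (by omega) hab; omega)
      | (have := eXX _ _ (by omega) (by omega) hab; omega)
      | (have := eZZ _ _ (by omega) (by omega) hab; omega)
      | (have := eUX _ _ (by omega) (by omega) hab; omega)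
      | (have := eUX _ _ (by omega) (by omega) hab.symm; omega)
      | (have := eUZ _ _ (by omega) (by omega) hab; omega)
      | (have := eUZ _ _ (by omega) (by omega) hab.symm; omega)
      | (have := eXZ _ _ (by omega) (by omega) hab; omega)
      | (have := eXZ _ _ (by omega) (by omega) hab.symm; omega)
  · have hU : ∀ i ≤ dU, ∃ a, φ a = gU i := fun i hi => by
      rcases Nat.lt_or_ge i s with h | h
      · exact ⟨.y ⟨s - 1 - i, by omega⟩, congrArg gU (show s - 1 - (s - 1 - i) = i by omega)⟩
      rcases Nat.lt_or_ge t i with h' | h'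
      · exact ⟨.u ⟨i - (t + 1), by omega⟩, congrArg gU (show t + 1 + (i - (t + 1)) = i by omega)⟩
      · exact ⟨.v ⟨i - s, by omega⟩, congrArg gU (show s + (i - s) = i by omega)⟩
    intro w
    change ∃ a, φ a = w
    rcases hcover w with ⟨i, hi, rfl⟩ | ⟨i, hi, rfl⟩ | ⟨i, hi, rfl⟩
    · exact hU i hi
    · rcases Nat.lt_or_ge t i with h | h
      · exact ⟨.x ⟨i - (t + 1), by omega⟩, congrArg gX (show t + 1 + (i - (t + 1)) = i by omega)⟩
      · rw [← (hUX i (by omega) hi).2 h]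
        exact hU i (by omega)
    · rcases Nat.lt_or_ge s i with h | h
      · exact ⟨.z ⟨i - (s + 1), by omega⟩, congrArg gZ (show s + 1 + (i - (s + 1)) = i by omega)⟩
      · rw [← (hUZ i (by omega) hi).2 h]
        exact hU i (by omega)

/-- A tree with four leaves is a four-leaf tree. Root it at one of its leaves: every vertex lies on
the geodesic to one of the other three leaves, and the two lowest of the three branching levels of
these geodesics coincide. -/
theorem exists_iso_fourLeafTree [Finite V] (hT : T.IsTree) (h4 : (leaves T).encard = 4) :
    ∃ k₁ k₂ k₃ k₄ k₅ : ℕ, 1 ≤ k₁ ∧ 1 ≤ k₂ ∧ 1 ≤ k₃ ∧ 1 ≤ k₄ ∧ 1 ≤ k₅ ∧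
      Nonempty (T ≃g fourLeafTree k₁ k₂ k₃ k₄ k₅) := by
  obtain ⟨r, L, hrL, hins, hL⟩ := Set.encard_eq_add_one_iff.1
    (show (leaves T).encard = 3 + 1 by rw [h4]; norm_num)
  obtain ⟨U, X, Z, nUX, nUZ, nXZ, rfl⟩ := Set.encard_eq_three.1 hL
  simp only [Set.mem_insert_iff, Set.mem_singleton_iff, not_or] at hrL
  obtain ⟨nrU, nrX, nrZ⟩ := hrL
  have hmem : ∀ l, l ∈ leaves T ↔ l = r ∨ l = U ∨ l = X ∨ l = Z := fun l => by
    rw [← hins]; simp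
  have hr := (hmem r).2 (by simp)
  have hU := (hmem U).2 (by simp)
  have hX := (hmem X).2 (by simp)
  have hZ := (hmem Z).2 (by simp)
  obtain ⟨gU, gU0, gUe, haU, hdU, hcU⟩ := exists_geodesic hT r U
  obtain ⟨gX, gX0, gXe, haX, hdX, hcX⟩ := exists_geodesic hT r X
  obtain ⟨gZ, gZ0, gZe, haZ, hdZ, hcZ⟩ := exists_geodesic hT r Z
  have hcover : ∀ w, (∃ i ≤ T.dist r U, gU i = w) ∨ (∃ i ≤ T.dist r X, gX i = w) ∨
      (∃ i ≤ T.dist r Z, gZ i = w) := fun w => by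
    by_cases hw : r = w
    · exact Or.inl ⟨0, zero_le, gU0.trans hw⟩
    obtain ⟨l, hl, hd⟩ := exists_leaf_dist_eq hT hw
    have hpos := hT.1.pos_dist_of_ne hw
    rcases (hmem l).1 hl with rfl | rfl | rfl | rfl
    · rw [dist_self] at hd
      omega
    · exact Or.inl ⟨_, by omega, hcU w hd⟩
    · exact Or.inr (Or.inl ⟨_, by omega, hcX w hd⟩)
    · exact Or.inr (Or.inr ⟨_, by omega, hcZ w hd⟩)
  obtain ⟨a, ha1, haU', haX', ha⟩ := exists_branching_level hT hr hU hX nrU nrX nUX gU0 gX0 gUe gXe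
    haU haX hdU hdX
  obtain ⟨b, hb1, hbU', hbZ', hb⟩ := exists_branching_level hT hr hU hZ nrU nrZ nUZ gU0 gZ0 gUe gZe
    haU haZ hdU hdZ
  obtain ⟨c, hc1, hcX', hcZ', hc⟩ := exists_branching_level hT hr hX hZ nrX nrZ nXZ gX0 gZ0 gXe gZe
    haX haZ hdX hdZ
  have h1 : min a b ≤ c := (hc _ (by omega) (by omega)).1
    (((ha (min a b) (by omega) (by omega)).2 (by omega)).symm.trans
      ((hb _ (by omega) (by omega)).2 (by omega)))
  have h2 : min a c ≤ b := (hb _ (by omega) (by omega)).1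
    (((ha (min a c) (by omega) (by omega)).2 (by omega)).trans
      ((hc _ (by omega) (by omega)).2 (by omega)))
  have h3 : min b c ≤ a := (ha _ (by omega) (by omega)).1
    (((hb (min b c) (by omega) (by omega)).2 (by omega)).trans
      ((hc _ (by omega) (by omega)).2 (by omega)).symm)
  have hswap : ∀ {g g' : ℕ → V} {m d d' : ℕ}, (∀ i ≤ d, i ≤ d' → (g i = g' i ↔ i ≤ m)) →
      ∀ i ≤ d', i ≤ d → (g' i = g i ↔ i ≤ m) := fun h i hi hi' => by
    rw [eq_comm]; exact h i hi' hi
  -- By `h1`, `h2`, `h3` the least of the three branching levels is attained twice; the geodesic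
  -- occurring in both of these pairs plays the role of `gZ`.
  rcases (by omega : (b = c ∧ b ≤ a) ∨ (a = c ∧ a ≤ b) ∨ (a = b ∧ a ≤ c)) with
    ⟨rfl, hle⟩ | ⟨rfl, hle⟩ | ⟨rfl, hle⟩
  · exact nonempty_iso_of_geodesics hT hb1 hle haU' haX' hbZ' haU haX haZ hdU hdX hdZ ha hb hc
      hcover
  · exact nonempty_iso_of_geodesics hT ha1 hle hbU' hbZ' haX' haU haZ haX hdU hdZ hdX hb ha
      (hswap hc) fun w => (hcover w).imp_right Or.symm
  · exact nonempty_iso_of_geodesics hT ha1 hle hcX' hcZ' haU' haX haZ haU hdX hdZ hdU hc (hswap ha)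
      (hswap hb) fun w => or_assoc.1 (hcover w).symm

/-- The parameters can be chosen with `k₃ ≤ k₂` and `k₅ ≤ k₄`, by exchanging the paths `u` and `x`,
or the paths `y` and `z`. -/
theorem exists_iso_fourLeafTree_ordered [Finite V] (hT : T.IsTree) (h4 : (leaves T).encard = 4) :
    ∃ k₁ k₂ k₃ k₄ k₅ : ℕ, 1 ≤ k₁ ∧ 1 ≤ k₃ ∧ k₃ ≤ k₂ ∧ 1 ≤ k₅ ∧ k₅ ≤ k₄ ∧
      Nonempty (T ≃g fourLeafTree k₁ k₂ k₃ k₄ k₅) := by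
  have hux : ∃ k₁ k₂ k₃ k₄ k₅ : ℕ, 1 ≤ k₁ ∧ 1 ≤ k₃ ∧ k₃ ≤ k₂ ∧ 1 ≤ k₄ ∧ 1 ≤ k₅ ∧
      Nonempty (T ≃g fourLeafTree k₁ k₂ k₃ k₄ k₅) := by
    obtain ⟨k₁, k₂, k₃, k₄, k₅, h₁, h₂, h₃, h₄, h₅, ⟨e⟩⟩ := exists_iso_fourLeafTree hT h4
    rcases le_total k₃ k₂ with h | h
    · exact ⟨k₁, k₂, k₃, k₄, k₅, h₁, h₃, h, h₄, h₅, ⟨e⟩⟩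
    · exact ⟨k₁, k₃, k₂, k₄, k₅, h₁, h₂, h, h₄, h₅, ⟨e.trans (fourLeafSwapUXIso ..)⟩⟩
  obtain ⟨k₁, k₂, k₃, k₄, k₅, h₁, h₃, h₃₂, h₄, h₅, ⟨e⟩⟩ := hux
  rcases le_total k₅ k₄ with h | h
  · exact ⟨k₁, k₂, k₃, k₄, k₅, h₁, h₃, h₃₂, h₅, h, ⟨e⟩⟩
  · exact ⟨k₁, k₂, k₃, k₅, k₄, h₁, h₃, h₃₂, h₄, h, ⟨((e.trans (fourLeafReverseIso ..)).trans
      (fourLeafSwapUXIso ..)).trans (fourLeafReverseIso ..)⟩⟩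

/-- The vertex `v₁` of the four-leaf tree has at least three neighbours. -/
theorem two_le_thresholdStrongDim_of_iso (hT : T.IsTree) {k₁ k₂ k₃ k₄ k₅ : ℕ} (h₁ : 1 ≤ k₁)
    (h₂ : 1 ≤ k₂) (h₄ : 1 ≤ k₄) (h₅ : 1 ≤ k₅) (e : T ≃g fourLeafTree k₁ k₂ k₃ k₄ k₅) :
    2 ≤ thresholdStrongDim T := by
  have hadj : ∀ a b, (fourLeafTree k₁ k₂ k₃ k₄ k₅).Adj a b → T.Adj (e.symm a) (e.symm b) :=
    fun a b h => e.symm.map_adj_iff.2 h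
  have hv : ∃ a, (fourLeafTree k₁ k₂ k₃ k₄ k₅).Adj (.v ⟨0, h₁⟩) a ∧ .y ⟨0, h₄⟩ ≠ a ∧
      .z ⟨0, h₅⟩ ≠ a := by
    by_cases h : k₁ = 1
    · exact ⟨.u ⟨0, h₂⟩, by simp [fourLeafTree, h], by simp, by simp⟩
    · exact ⟨.v ⟨1, by omega⟩, by simp [fourLeafTree], by simp, by simp⟩
  obtain ⟨a, ha, hy, hz⟩ := hv
  exact two_le_thresholdStrongDim hT.1 (hadj (.v ⟨0, h₁⟩) (.y ⟨0, h₄⟩) (by simp [fourLeafTree]))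
    (hadj (.v ⟨0, h₁⟩) (.z ⟨0, h₅⟩) (by simp [fourLeafTree])) (hadj _ a ha)
    (e.symm.injective.ne (by simp)) (e.symm.injective.ne hy) (e.symm.injective.ne hz)

end Classification

end StrongDimension

theorem mainTheorem6 {V : Type*} [Finite V] (T : SimpleGraph V) (hT : T.IsTree) :
    (StrongDimension.strongDim T = 3 ↔ (StrongDimension.leaves T).encard = 4) ∧
    (StrongDimension.strongDim T = 3 →
      StrongDimension.thresholdStrongDim T = 2 ∧
      (∃ k₁ k₂ k₃ k₄ k₅ : ℕ, 1 ≤ k₁ ∧ 1 ≤ k₃ ∧ k₃ ≤ k₂ ∧ 1 ≤ k₅ ∧ k₅ ≤ k₄ ∧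
        Nonempty (T ≃g StrongDimension.fourLeafTree k₁ k₂ k₃ k₄ k₅)) ∧
      (∀ (k₁ k₂ k₃ k₄ k₅ : ℕ) (_ : 1 ≤ k₁) (h₃ : 1 ≤ k₃) (h₂ : k₃ ≤ k₂) (h₅ : 1 ≤ k₅)
        (h₄ : k₅ ≤ k₄) (e : T ≃g StrongDimension.fourLeafTree k₁ k₂ k₃ k₄ k₅),
        ∃ φ : V → Fin 2 → Fin (T.diam + 1),
          StrongDimension.IsResolvedEmbedding T
            ![e.symm (.y ⟨k₄ - 1, by omega⟩), e.symm (.u ⟨k₂ - 1, by omega⟩)] φ ∧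
          StrongDimension.HasIsometricImage φ)) := by
  refine ⟨StrongDimension.strongDim_eq_three_iff hT, fun h3 => ?_⟩
  have hiso := StrongDimension.exists_iso_fourLeafTree_ordered hT
    ((StrongDimension.strongDim_eq_three_iff hT).1 h3)
  refine ⟨?_, hiso, fun k₁ k₂ k₃ k₄ k₅ h₁ h₃ h₂ h₅ h₄ e => ?_⟩
  · obtain ⟨k₁, k₂, k₃, k₄, k₅, h₁, h₃, h₂, h₅, h₄, ⟨e⟩⟩ := hiso
    obtain ⟨f, g, H⟩ := StrongDimension.exists_isResolvedPlacement h₁ h₃ h₂ h₅ h₄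
      (by omega) (by omega)
    exact le_antisymm (H.comp_iso e).thresholdStrongDim_le_two
      (StrongDimension.two_le_thresholdStrongDim_of_iso hT h₁ (h₃.trans h₂) (h₅.trans h₄) h₅ e)
  · obtain ⟨f, g, H⟩ := StrongDimension.exists_isResolvedPlacement h₁ h₃ h₂ h₅ h₄
      (by omega) (by omega)
    exact (H.comp_iso e).exists_isResolvedEmbedding hT.1
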